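/- Let $N\ge 1$. All functions are real-valued on $\mathbb{R}^N$. Let $S_0$ be the completion of $C_0^\infty(\mathbb{R}^N)$ under the norm $$\Big(\int_{\mathbb{R}^N}|\nabla u|^2\,dx\Big)^{1/2}+\Big(\int_{\mathbb{R}^N}|u|^2|x|^2\,dx\Big)^{1/2},$$ regarded as a space of functions (modulo equality almost everywhere) with weak gradient $\nabla u$. For $u\in S_0$ put $$\delta_1(u)=\Big(\int_{\mathbb{R}^N}|\nabla u|^2\,dx\Big)^{1/2}\Big(\int_{\mathbb{R}^N}|u|^2|x|^2\,dx\Big)^{1/2}-\frac N2\int_{\mathbb{R}^N}|u|^2\,dx ,$$ for a set $A$ of functions put $d_1(u,A)=\inf_{v\in A}\|u-v\|_{L^2(\mathbb{R}^N)}$, and let $$E_{HUP}=\{\alpha e^{-\beta|x|^2}:\alpha\in\mathbb{R},\ \beta>0\},\qquad F=\{(\alpha+\gamma\cdot x)e^{-\beta|x|^2}:\alpha\in\mathbb{R},\ \gamma\in\mathbb{R}^N,\ \beta>0\},$$ $$d_2(u,F)=\inf_{c\in\mathbb{R},\ d\in\mathbb{R}^N,\ \lambda\ne0}\Big(\int_{\mathbb{R}^N}\Big|u-ce^{-\frac{|x|^2}{2\lambda^2}}\Big|^2+\Big|u-(c+d\cdot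 x)e^{-\frac{|x|^2}{2\lambda^2}}\Big|^2dx\Big)^{1/2}.$$ Then every $u\in S_0$ belongs to $L^2(\mathbb{R}^N)$ (so that all the quantities above are finite) and satisfies $$\delta_1(u)\ \ge\ d_2(u,F)^2 .$$ As a consequence, for every $u\in S_0$, $$\delta_1(u)-d_1(u,E_{HUP})^2\ \ge\ d_1(u,F)^2 .$$ -/

import Mathlib

open MeasureTheory Filter Topology
open scoped ContDiff

noncomputable section

namespace HUP

/-- Real-valued test functions on `ℝ^N`: smooth with compact support. -/
def IsTestFunction {N : ℕ} (φ : EuclideanSpace ℝ (Fin N) → ℝ) : Prop :=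
  ContDiff ℝ ∞ φ ∧ HasCompactSupport φ

/-- `G` is a weak gradient of `u`: both are locally integrable, and
`∫ u ∇φ dx = - ∫ φ G dx` for every test function `φ`. -/
def IsWeakGradient {N : ℕ} (u : EuclideanSpace ℝ (Fin N) → ℝ)
    (G : EuclideanSpace ℝ (Fin N) → EuclideanSpace ℝ (Fin N)) : Prop :=
  LocallyIntegrable u volume ∧ LocallyIntegrable G volume ∧
    ∀ φ : EuclideanSpace ℝ (Fin N) → ℝ, IsTestFunction φ →
      ∫ x, u x • gradient φ x = -∫ x, φ x • G x

open Classical in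
/-- The weak gradient `∇u` (unique almost everywhere, see `IsWeakGradient.ae_eq`), for functions
that have one. -/
def weakGradient {N : ℕ} (u : EuclideanSpace ℝ (Fin N) → ℝ) :
    EuclideanSpace ℝ (Fin N) → EuclideanSpace ℝ (Fin N) :=
  if h : ∃ G, IsWeakGradient u G then h.choose else 0

theorem IsWeakGradient.ae_eq {N : ℕ} {u : EuclideanSpace ℝ (Fin N) → ℝ}
    {G H : EuclideanSpace ℝ (Fin N) → EuclideanSpace ℝ (Fin N)}
    (hG : IsWeakGradient u G) (hH : IsWeakGradient u H) : G =ᵐ[volume] H := by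
  refine ae_eq_of_integral_contDiff_smul_eq hG.2.1 hH.2.1 fun φ h1 h2 => ?_
  have := (hG.2.2 φ ⟨h1, h2⟩).symm.trans (hH.2.2 φ ⟨h1, h2⟩)
  exact neg_injective this

theorem IsWeakGradient.weakGradient {N : ℕ} {u : EuclideanSpace ℝ (Fin N) → ℝ}
    (h : ∃ G, IsWeakGradient u G) : IsWeakGradient u (weakGradient u) := by
  rw [HUP.weakGradient, dif_pos h]
  exact h.choose_spec

/-- The space `S₀`, the completion of `C₀^∞(ℝ^N)` under the norm
`‖u‖ = (∫ |∇u|² dx)^(1/2) + (∫ |u|² |x|² dx)^(1/2)`, realised as a space of (almost everywhere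
classes of) functions: those weakly differentiable `u` that are limits, in this norm, of
a sequence of test functions. -/
def MemS0 {N : ℕ} (u : EuclideanSpace ℝ (Fin N) → ℝ) : Prop :=
  (∃ G, IsWeakGradient u G) ∧
    ∃ φ : ℕ → EuclideanSpace ℝ (Fin N) → ℝ, (∀ n, IsTestFunction (φ n)) ∧
      Tendsto (fun n =>
          eLpNorm (fun x => weakGradient u x - gradient (φ n) x) 2 volume
            + eLpNorm (fun x => ‖x‖ * (u x - φ n x)) 2 volume)
        atTop (𝓝 0)

/-- The Heisenberg deficit
`δ₁(u) = (∫ |∇u|² dx)^(1/2) (∫ |u|² |x|² dx)^(1/2) - (N/2) ∫ |u|² dx`. -/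
def deficit {N : ℕ} (u : EuclideanSpace ℝ (Fin N) → ℝ) : ℝ :=
  √(∫ x, ‖weakGradient u x‖ ^ 2) * √(∫ x, |u x| ^ 2 * ‖x‖ ^ 2)
    - (N : ℝ) / 2 * ∫ x, |u x| ^ 2

/-- `d₁(u, A) = inf_{v ∈ A} ‖u - v‖₂`. -/
def distL2 {N : ℕ} (u : EuclideanSpace ℝ (Fin N) → ℝ)
    (A : Set (EuclideanSpace ℝ (Fin N) → ℝ)) : ℝ :=
  ⨅ v : A, √(∫ x, |u x - v.1 x| ^ 2)

/-- `E_HUP`, the set of all `α e^{-β|x|²}` with `α ∈ ℝ` and `β > 0`. -/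
def gaussians (N : ℕ) : Set (EuclideanSpace ℝ (Fin N) → ℝ) :=
  {v | ∃ α β : ℝ, 0 < β ∧ v = fun x => α * Real.exp (-β * ‖x‖ ^ 2)}

/-- `F`, the set of all `(α + γ·x) e^{-β|x|²}` with `α ∈ ℝ`, `γ ∈ ℝ^N` and `β > 0`. -/
def affineGaussians (N : ℕ) : Set (EuclideanSpace ℝ (Fin N) → ℝ) :=
  {v | ∃ (α : ℝ) (γ : EuclideanSpace ℝ (Fin N)) (β : ℝ), 0 < β ∧
    v = fun x => (α + inner ℝ γ x) * Real.exp (-β * ‖x‖ ^ 2)}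

/-- `d₂(u, F)`, the infimum over `c ∈ ℝ`, `d ∈ ℝ^N` and `lam ≠ 0` (the triple is `p`) of
`(∫ |u - c e^{-|x|²/(2 lam²)}|² + |u - (c + d·x) e^{-|x|²/(2 lam²)}|² dx)^(1/2)`. -/
def dist2 {N : ℕ} (u : EuclideanSpace ℝ (Fin N) → ℝ) : ℝ :=
  ⨅ p : ℝ × EuclideanSpace ℝ (Fin N) × {lam : ℝ // lam ≠ 0},
    √(∫ x, (|u x - p.1 * Real.exp (-(1 / (2 * p.2.2.1 ^ 2)) * ‖x‖ ^ 2)| ^ 2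
      + |u x - (p.1 + inner ℝ p.2.1 x) * Real.exp (-(1 / (2 * p.2.2.1 ^ 2)) * ‖x‖ ^ 2)| ^ 2))

end HUP

end

/-!
For a dilation parameter `t > 0`, put
`E_t(u) = (t ‖∇u‖² + ‖|x| u‖² / t) / 2 - (N / 2) ‖u‖²`. This is the quadratic form of the harmonic
oscillator `(-tΔ + |x|²/t - N) / 2`, whose eigenvalues are `0, 1, 2, …`; the eigenspaces for `0` and
`1` are spanned by `g = e^{-|x|²/(2t)}` and by the functions `(d·x) g`. If `u = ∑ uₖ` is the spectral
decomposition, then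
`E_t(u) = ∑ k ‖uₖ‖² ≥ ∑_{k ≥ 1} ‖uₖ‖² + ∑_{k ≥ 2} ‖uₖ‖² = ‖u - u₀‖² + ‖u - u₀ - u₁‖²`,
and the right side is at least `d₂(u, F)²`. Minimizing over `t` turns `E_t(u)` into `δ₁(u)`
(`le_sqrt_mul_sqrt_of_forall`). The statement about `d₁` follows because each of the two terms in
`d₂` is bounded below by the corresponding distance `d₁`.

Only the inequality `E_t(u) ≥ ∑ k ‖uₖ‖²` is needed, and no explicit Hermite basis.
In the variable `p = w / g` the oscillator becomes the number operator
`L = ∑ᵢ (xᵢ ∂ᵢ - (t/2) ∂ᵢ²)`, which is symmetric and acts on polynomials of degree `k` as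
multiplication by `k` up to lower degree (`numberOp_sub_smul_mem`). So the component of `u` of degree
exactly `k` is an eigenvector, and the decomposition comes from orthogonal projections onto the
finite-dimensional spaces of polynomials of bounded degree times `g`
(`exists_norm_sub_sq_add_le_of_graded`). These spaces exhaust `L²`
(`ae_eq_zero_of_forall_integral_mul_gaussPoly`). The link with `E_t(u)` is positivity of `E_t` at
`u - p g`, which for test functions is an integration by parts (`IsTestFunction.energy_le`) and in
which all terms are continuous for the norm of `S₀` (`MemS0.energy_le`). That this norm controls the
`L²` norm is the case `t = 1`, `p = 0` of the same inequality.
-/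

namespace HUP

/-! ### An abstract spectral gap -/

/-- Abstract spectral gap. A symmetric operator `L` on a filtered space acts on the `k`-th graded
piece as multiplication by `k`, up to terms of lower filtration degree. In the Hilbert space, the
component `e k` of `u` orthogonal to `T (V k)` inside `T (V (k + 1))` is then an eigenvector with
eigenvalue `k`. The hypothesis `hE` (a form version of `⟪u, L u⟫ ≤ E`) at the partial sums of the
`e k` yields `∑ k ‖e k‖² ≤ E`, and `k ≥ 1 + 1` for `k ≥ 2` bounds the two tails.

The degree-one component is written `T (L p₁)`, not `T p₁`: the two agree in `H`, but for the number
operator `L p₁` has no constant term. -/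
theorem exists_norm_sub_sq_add_le_of_graded {H P : Type*} [NormedAddCommGroup H]
    [InnerProductSpace ℝ H] [AddCommGroup P] [Module ℝ P] (T : P →ₗ[ℝ] H) (L : P →ₗ[ℝ] P)
    (V : ℕ → Submodule ℝ P) (hV0 : V 0 = ⊥) (hV : Monotone V) (hfin : ∀ n, Module.Finite ℝ (V n))
    (hdense : ⊤ ≤ (⨆ n, (V n).map T).topologicalClosure)
    (hsymm : ∀ p q, inner ℝ (T (L p)) (T q) = inner ℝ (T p) (T (L q)))
    (hgrade : ∀ k, ∀ p ∈ V (k + 1), L p - (k : ℝ) • p ∈ V k)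
    (u : H) (E : ℝ) (hE : ∀ p, 2 * inner ℝ u (T (L p)) - inner ℝ (T p) (T (L p)) ≤ E) :
    ∃ p₀ ∈ V 1, ∃ p₁ ∈ V 2, ‖u - T p₀‖ ^ 2 + ‖u - (T p₀ + T (L p₁))‖ ^ 2 ≤ E := by
  have hinv : ∀ k, ∀ p ∈ V k, L p ∈ V k := by
    intro k p hp
    cases k with
    | zero => simp_all
    | succ k =>
      have h := hV (Nat.le_succ k) (hgrade k p hp)
      simpa using add_mem h ((V (k + 1)).smul_mem (k : ℝ) hp)
  set W : ℕ → Submodule ℝ H := fun n => (V n).map T with hW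
  have hWmono : Monotone W := fun a b hab => Submodule.map_mono (hV hab)
  have hWfin : ∀ n, FiniteDimensional ℝ (W n) := fun n => by
    have := hfin n
    exact inferInstanceAs (Module.Finite ℝ ((V n).map T))
  set x : ℕ → H := fun n => (W n).starProjection u with hx
  have hxW : ∀ n, x n ∈ W n := fun n => Submodule.starProjection_apply_mem _ _
  have hxproj : ∀ n, ∀ w ∈ W n, inner ℝ (x n) w = inner ℝ u w := by
    intro n w hw
    have h : inner ℝ (u - x n) w = 0 := Submodule.starProjection_inner_eq_zero u w hw
    rw [inner_sub_left] at h
    linarith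
  have hxlim : Tendsto x atTop (𝓝 u) := Submodule.starProjection_tendsto_self W hWmono u hdense
  have hx0 : x 0 = 0 := by
    have h := hxW 0
    simpa [hW, hV0] using h
  set e : ℕ → H := fun k => x (k + 1) - x k with he
  have heW : ∀ k, e k ∈ W (k + 1) := fun k =>
    sub_mem (hxW _) (hWmono (Nat.le_succ k) (hxW k))
  have heperp : ∀ k, ∀ w ∈ W k, inner ℝ (e k) w = 0 := by
    intro k w hw
    simp only [he]
    rw [inner_sub_left, hxproj k w hw, hxproj (k + 1) w (hWmono (Nat.le_succ k) hw), sub_self]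
  choose q hqV hqT using fun k => Submodule.mem_map.1 (heW k)
  have heig : ∀ k, T (L (q k)) = (k : ℝ) • e k := by
    intro k
    set r := L (q k) - (k : ℝ) • q k with hr
    have hrV : r ∈ V k := hgrade k _ (hqV k)
    -- `T r` is orthogonal to `T (V k)` by symmetry, and lies in it, hence vanishes
    have h : ∀ w ∈ V k, inner ℝ (T r) (T w) = 0 := by
      intro w hw
      rw [hr, map_sub, map_smul, inner_sub_left, hsymm, inner_smul_left, hqT,
        heperp k _ (Submodule.mem_map_of_mem (hinv k w hw)),
        heperp k _ (Submodule.mem_map_of_mem hw)]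
      simp
    have h0 := inner_self_eq_zero.1 (h r hrV)
    rw [hr, map_sub, map_smul, hqT, sub_eq_zero] at h0
    exact h0
  have hxe : ∀ k, x (k + 1) = x k + e k := fun k => by simp [he]
  have hue : ∀ k, inner ℝ u (e k) = ‖e k‖ ^ 2 := by
    intro k
    rw [← hxproj (k + 1) _ (heW k), hxe, inner_add_left, real_inner_comm,
      heperp k _ (hxW k), real_inner_self_eq_norm_sq, zero_add]
  have hxsq : ∀ n, ‖x n‖ ^ 2 = ∑ k ∈ Finset.range n, ‖e k‖ ^ 2 := by
    intro n
    induction n with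
    | zero => simp [hx0]
    | succ n ih =>
      rw [Finset.sum_range_succ, ← ih, hxe, norm_add_sq_real, real_inner_comm,
        heperp n _ (hxW n)]
      ring
  have hxsum : ∀ n, x n = ∑ k ∈ Finset.range n, e k := by
    intro n
    induction n with
    | zero => simp [hx0]
    | succ n ih => rw [Finset.sum_range_succ, ← ih, hxe]
  have hsum : ∀ n, ∑ k ∈ Finset.range n, (k : ℝ) * ‖e k‖ ^ 2 ≤ E := by
    intro n
    have h := hE (∑ k ∈ Finset.range n, q k)
    have h1 : T (∑ k ∈ Finset.range n, q k) = x n := by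
      rw [map_sum, hxsum]
      exact Finset.sum_congr rfl fun k _ => hqT k
    have h2 : T (L (∑ k ∈ Finset.range n, q k)) = ∑ k ∈ Finset.range n, (k : ℝ) • e k := by
      rw [map_sum, map_sum]
      exact Finset.sum_congr rfl fun k _ => heig k
    have h3 : ∑ k ∈ Finset.range n, (k : ℝ) • e k ∈ W n :=
      Submodule.sum_mem _ fun k hk =>
        (W n).smul_mem _ (hWmono (Finset.mem_range.1 hk) (heW k))
    rw [h1, h2, hxproj n _ h3] at h
    have h4 : inner ℝ u (∑ k ∈ Finset.range n, (k : ℝ) • e k)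
        = ∑ k ∈ Finset.range n, (k : ℝ) * ‖e k‖ ^ 2 := by
      rw [inner_sum]
      exact Finset.sum_congr rfl fun k _ => by rw [inner_smul_right, hue]
    linarith
  have hbound : ∀ n, 2 * ‖x (n + 2)‖ ^ 2 - 2 * ‖e 0‖ ^ 2 - ‖e 1‖ ^ 2 ≤ E := by
    intro n
    refine le_trans ?_ (hsum (n + 2))
    -- the terms `k = 0, 1` are split off, and `2 ≤ k` is used in the others
    rw [hxsq, Finset.sum_range_succ', Finset.sum_range_succ', Finset.sum_range_succ',
      Finset.sum_range_succ']
    have : ∑ k ∈ Finset.range n, 2 * ‖e (k + 1 + 1)‖ ^ 2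
        ≤ ∑ k ∈ Finset.range n, ((k + 1 + 1 : ℕ) : ℝ) * ‖e (k + 1 + 1)‖ ^ 2 :=
      Finset.sum_le_sum fun k _ => by
        gcongr
        push_cast
        linarith [(Nat.cast_nonneg k : (0 : ℝ) ≤ k)]
    rw [← Finset.mul_sum] at this
    push_cast at this ⊢
    nlinarith
  have hlim : 2 * ‖u‖ ^ 2 - 2 * ‖e 0‖ ^ 2 - ‖e 1‖ ^ 2 ≤ E := by
    have h := (((hxlim.comp (tendsto_add_atTop_nat 2)).norm.pow 2).const_mul 2).sub_const
      (2 * ‖e 0‖ ^ 2) |>.sub_const (‖e 1‖ ^ 2)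
    exact le_of_tendsto' h hbound
  refine ⟨q 0, hqV 0, q 1, hqV 1, ?_⟩
  rw [hqT, heig, Nat.cast_one, one_smul, norm_sub_sq_real u (e 0), norm_sub_sq_real u (e 0 + e 1),
    inner_add_right, norm_add_sq_real, hue, hue, real_inner_comm, heperp 1 _ (heW 0)]
  linarith

/-! ### The number operator on polynomials, graded by degree -/

open MvPolynomial

variable {N : ℕ}

/-- Polynomials of total degree less than `n`. The strict bound makes `degreeLT N 0` trivial. -/
noncomputable def degreeLT (N n : ℕ) : Submodule ℝ (MvPolynomial (Fin N) ℝ) :=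
  restrictSupport ℝ {α | α.degree < n}

theorem degreeLT_zero : degreeLT N 0 = ⊥ := by
  simp [degreeLT, restrictSupport_eq_span]

theorem degreeLT_mono : Monotone (degreeLT N) := fun _ _ h =>
  restrictSupport_mono ℝ fun _ hα => lt_of_lt_of_le hα h

instance (n : ℕ) : Module.Finite ℝ (degreeLT N n) := by
  rw [degreeLT, restrictSupport_eq_span]
  have h : {α : Fin N →₀ ℕ | α.degree < n}.Finite :=
    (Finsupp.finite_of_degree_le n).subset (fun α hα => le_of_lt (show α.degree < n from hα))
  exact Module.Finite.span_of_finite ℝ (h.image _)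

theorem iSup_degreeLT : ⨆ n, degreeLT N n = ⊤ := by
  refine eq_top_iff.2 fun p _ => ?_
  refine Submodule.mem_iSup_of_mem (p.totalDegree + 1) ?_
  rw [degreeLT, mem_restrictSupport_iff]
  intro α hα
  exact Nat.lt_succ_of_le (le_totalDegree hα)

/-- A linear map sends `degreeLT N n` into `S` as soon as it does so on monomials. -/
theorem map_mem_of_mem_degreeLT {n : ℕ} {S : Submodule ℝ (MvPolynomial (Fin N) ℝ)}
    (f : MvPolynomial (Fin N) ℝ →ₗ[ℝ] MvPolynomial (Fin N) ℝ)
    (h : ∀ α : Fin N →₀ ℕ, α.degree < n → f (monomial α 1) ∈ S)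
    {p : MvPolynomial (Fin N) ℝ} (hp : p ∈ degreeLT N n) : f p ∈ S := by
  rw [degreeLT, restrictSupport_eq_span] at hp
  have : Submodule.span ℝ ((fun α => monomial α (1 : ℝ)) '' {α : Fin N →₀ ℕ | α.degree < n})
      ≤ S.comap f := by
    rw [Submodule.span_le]
    rintro _ ⟨α, hα, rfl⟩
    exact h α hα
  exact this hp

theorem monomial_mem_degreeLT {n : ℕ} {α : Fin N →₀ ℕ} (h : α.degree < n) (a : ℝ) :
    monomial α a ∈ degreeLT N n :=
  (monomial_mem_restrictSupport ℝ).2 (Or.inl h)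

theorem pderiv_mem_degreeLT {n : ℕ} {p : MvPolynomial (Fin N) ℝ} (i : Fin N)
    (hp : p ∈ degreeLT N (n + 1)) : pderiv i p ∈ degreeLT N n := by
  refine map_mem_of_mem_degreeLT (pderiv i).toLinearMap (fun α hα => ?_) hp
  rw [Derivation.coeFn_coe, pderiv_monomial]
  rcases Nat.eq_zero_or_pos (α i) with h0 | h0
  · simp [h0]
  · refine monomial_mem_degreeLT ?_ _
    have h1 : α - Finsupp.single i 1 + Finsupp.single i 1 = α :=
      tsub_add_cancel_of_le (Finsupp.single_le_iff.2 h0)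
    have h2 := congrArg Finsupp.degree h1
    rw [map_add, Finsupp.degree_single] at h2
    omega

theorem eq_C_of_mem_degreeLT_one {p : MvPolynomial (Fin N) ℝ} (hp : p ∈ degreeLT N 1) :
    p = C (coeff 0 p) := by
  rw [degreeLT, mem_restrictSupport_iff] at hp
  ext α
  rw [coeff_C]
  split_ifs with h
  · rw [h]
  · by_contra h0
    have h1 : α.degree < 1 := hp (mem_support_iff.2 h0)
    exact h ((Finsupp.degree_eq_zero_iff α).1 (by omega)).symm

/-- The number operator `L p = ∑ᵢ (xᵢ ∂ᵢp - (t/2) ∂ᵢ²p)`: the conjugate of the harmonic oscillator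
`(-tΔ + |x|²/t - N)/2` by the Gaussian `e^{-|x|²/(2t)}`. -/
noncomputable def numberOp (N : ℕ) (t : ℝ) :
    MvPolynomial (Fin N) ℝ →ₗ[ℝ] MvPolynomial (Fin N) ℝ :=
  ∑ i, (LinearMap.mulLeft ℝ (X i) ∘ₗ (pderiv i).toLinearMap
    - (t / 2) • ((pderiv i).toLinearMap ∘ₗ (pderiv i).toLinearMap))

theorem numberOp_apply (t : ℝ) (p : MvPolynomial (Fin N) ℝ) :
    numberOp N t p = ∑ i, (X i * pderiv i p - (t / 2) • pderiv i (pderiv i p)) := by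
  simp [numberOp]

/-- Euler's identity: `L` is multiplication by `k` on degree `k`, up to lower degree. -/
theorem numberOp_sub_smul_mem (t : ℝ) (k : ℕ) {p : MvPolynomial (Fin N) ℝ}
    (hp : p ∈ degreeLT N (k + 1)) : numberOp N t p - (k : ℝ) • p ∈ degreeLT N k := by
  refine map_mem_of_mem_degreeLT (numberOp N t - (k : ℝ) • LinearMap.id) (fun α hα => ?_) hp
  have heuler := (isHomogeneous_monomial (1 : ℝ) (d := α) rfl).sum_X_mul_pderiv
  simp only [LinearMap.sub_apply, LinearMap.smul_apply, LinearMap.id_apply, numberOp_apply,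
    Finset.sum_sub_distrib]
  rw [heuler, sub_right_comm]
  refine sub_mem ?_ (Submodule.sum_mem _ fun i _ => Submodule.smul_mem _ _ ?_)
  · rcases (Nat.lt_succ_iff_lt_or_eq.1 hα) with h | h
    · exact sub_mem (nsmul_mem (monomial_mem_degreeLT h 1) _)
        (Submodule.smul_mem _ _ (monomial_mem_degreeLT h 1))
    · rw [h, Nat.cast_smul_eq_nsmul, sub_self]
      exact zero_mem _
  · exact pderiv_mem_degreeLT i (degreeLT_mono (Nat.le_succ k)
      (pderiv_mem_degreeLT i (monomial_mem_degreeLT hα 1)))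

theorem numberOp_eq_of_mem_degreeLT_two (t : ℝ) {p : MvPolynomial (Fin N) ℝ}
    (hp : p ∈ degreeLT N 2) : ∃ d : Fin N → ℝ, numberOp N t p = ∑ i, X i * C (d i) := by
  refine ⟨fun i => coeff 0 (pderiv i p), ?_⟩
  rw [numberOp_apply]
  refine Finset.sum_congr rfl fun i _ => ?_
  have h := eq_C_of_mem_degreeLT_one (pderiv_mem_degreeLT i hp)
  rw [← h, h]
  simp

/-! ### Polynomials times Gaussians and integration by parts -/

/-- The polynomial `p` times the Gaussian `e^{-b|x|²}`, as a function on `ℝ^N`. -/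
noncomputable def gaussPoly (b : ℝ) (p : MvPolynomial (Fin N) ℝ) (x : EuclideanSpace ℝ (Fin N)) :
    ℝ :=
  eval (fun i => x i) p * Real.exp (-b * ‖x‖ ^ 2)

theorem gaussPoly_add (b : ℝ) (p q : MvPolynomial (Fin N) ℝ) (x : EuclideanSpace ℝ (Fin N)) :
    gaussPoly b (p + q) x = gaussPoly b p x + gaussPoly b q x := by
  simp [gaussPoly, add_mul]

theorem gaussPoly_smul (b c : ℝ) (p : MvPolynomial (Fin N) ℝ) (x : EuclideanSpace ℝ (Fin N)) :
    gaussPoly b (c • p) x = c * gaussPoly b p x := by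
  simp [gaussPoly, smul_eval, mul_assoc]

theorem gaussPoly_mul_gaussPoly (b c : ℝ) (p q : MvPolynomial (Fin N) ℝ)
    (x : EuclideanSpace ℝ (Fin N)) :
    gaussPoly b p x * gaussPoly c q x = gaussPoly (b + c) (p * q) x := by
  have : -(b + c) * ‖x‖ ^ 2 = -b * ‖x‖ ^ 2 + -c * ‖x‖ ^ 2 := by ring
  simp only [gaussPoly, map_mul, this, Real.exp_add]
  ring

theorem contDiff_eval (p : MvPolynomial (Fin N) ℝ) :
    ContDiff ℝ ∞ fun x : EuclideanSpace ℝ (Fin N) => eval (fun i => x i) p := by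
  induction p using MvPolynomial.induction_on with
  | C a => simpa using contDiff_const
  | add p q hp hq => simpa using hp.add hq
  | mul_X p i hp =>
    simp only [map_mul, eval_X]
    exact hp.mul (by fun_prop)

theorem fderiv_eval (p : MvPolynomial (Fin N) ℝ) (i : Fin N) (x : EuclideanSpace ℝ (Fin N)) :
    fderiv ℝ (fun x : EuclideanSpace ℝ (Fin N) => eval (fun i => x i) p) x
      (EuclideanSpace.single i 1) = eval (fun i => x i) (pderiv i p) := by
  have hd : ∀ q : MvPolynomial (Fin N) ℝ, DifferentiableAt ℝ
      (fun x : EuclideanSpace ℝ (Fin N) => eval (fun i => x i) q) x :=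
    fun q => (contDiff_eval q).contDiffAt.differentiableAt (by simp)
  induction p using MvPolynomial.induction_on with
  | C a => simp
  | add p q hp hq =>
    simp only [map_add]
    rw [fderiv_fun_add (hd p) (hd q)]
    simp [hp, hq]
  | mul_X p j hp =>
    have hX : fderiv ℝ (fun x : EuclideanSpace ℝ (Fin N) => x j) x = EuclideanSpace.proj j :=
      (EuclideanSpace.proj j : EuclideanSpace ℝ (Fin N) →L[ℝ] ℝ).fderiv
    simp only [map_mul, eval_X]
    rw [fderiv_fun_mul (hd p) (by fun_prop), hX]
    simp [hp, Derivation.leibniz, pderiv_X, Pi.single_apply, eq_comm]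
    ring_nf
    split_ifs <;> simp

theorem contDiff_gaussPoly (b : ℝ) (p : MvPolynomial (Fin N) ℝ) : ContDiff ℝ ∞ (gaussPoly b p) := by
  unfold gaussPoly
  exact (contDiff_eval p).mul ((contDiff_const.mul (contDiff_norm_sq ℝ)).exp)

theorem continuous_gaussPoly (b : ℝ) (p : MvPolynomial (Fin N) ℝ) : Continuous (gaussPoly b p) :=
  (contDiff_gaussPoly b p).continuous

theorem fderiv_gaussPoly (b : ℝ) (p : MvPolynomial (Fin N) ℝ) (i : Fin N)
    (x : EuclideanSpace ℝ (Fin N)) :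
    fderiv ℝ (gaussPoly b p) x (EuclideanSpace.single i 1)
      = gaussPoly b (pderiv i p - (2 * b) • (X i * p)) x := by
  have h1 : HasFDerivAt (fun x : EuclideanSpace ℝ (Fin N) => Real.exp (-b * ‖x‖ ^ 2)) _ x :=
    (((hasFDerivAt_id x).norm_sq).const_mul (-b)).exp
  have h2 := ((contDiff_eval p).contDiffAt.differentiableAt (x := x) (by simp)).hasFDerivAt
  have h3 : HasFDerivAt (gaussPoly b p) _ x := h2.mul h1
  rw [h3.fderiv]
  simp [fderiv_eval, gaussPoly, smul_eval, EuclideanSpace.inner_single_right]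
  ring

theorem integrable_exp_neg_mul_norm_sq {b : ℝ} (hb : 0 < b) :
    Integrable fun x : EuclideanSpace ℝ (Fin N) => Real.exp (-b * ‖x‖ ^ 2) := by
  have h := (GaussianFourier.integrable_cexp_neg_mul_sq_norm_add
    (V := EuclideanSpace ℝ (Fin N)) (b := b) (by simpa using hb) 0 0).norm
  refine h.congr (Eventually.of_forall fun x => ?_)
  simp only [Complex.norm_exp]
  norm_cast
  simp

theorem integrable_gaussPoly {b : ℝ} (hb : 0 < b) (p : MvPolynomial (Fin N) ℝ) :
    Integrable (gaussPoly b p) := by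
  induction p using MvPolynomial.induction_on generalizing b with
  | C a =>
    unfold gaussPoly
    simpa using (integrable_exp_neg_mul_norm_sq hb).const_mul a
  | add p q hp hq =>
    refine ((hp hb).add (hq hb)).congr (Eventually.of_forall fun x => ?_)
    simp [gaussPoly_add]
  | mul_X p i hp =>
    have hb2 : 0 < b / 2 := by positivity
    -- half of the Gaussian absorbs the factor `x i`
    have hbd : ∀ x : EuclideanSpace ℝ (Fin N), ‖gaussPoly (b / 2) (X i) x‖ ≤ 1 + 1 / b := by
      intro x
      have h1 : |x i| ≤ ‖x‖ := PiLp.norm_apply_le x i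
      have h2 : 1 + b / 2 * ‖x‖ ^ 2 ≤ Real.exp (b / 2 * ‖x‖ ^ 2) := by
        linarith [Real.add_one_le_exp (b / 2 * ‖x‖ ^ 2)]
      have h3 : ‖x‖ ≤ (1 + 1 / b) * (1 + b / 2 * ‖x‖ ^ 2) := by
        have h4 : (1 + 1 / b) * (1 + b / 2 * ‖x‖ ^ 2)
            = 1 + 1 / b + b / 2 * ‖x‖ ^ 2 + ‖x‖ ^ 2 / 2 := by
          field_simp
          ring
        have h5 : 0 ≤ 1 / b := by positivity
        have h6 : 0 ≤ b / 2 * ‖x‖ ^ 2 := by positivity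
        nlinarith [sq_nonneg (‖x‖ - 1)]
      simp only [gaussPoly, eval_X, norm_mul, Real.norm_eq_abs, neg_mul, Real.exp_neg,
        abs_inv, Real.abs_exp]
      rw [← div_eq_mul_inv, div_le_iff₀ (Real.exp_pos _)]
      exact h1.trans (h3.trans (by gcongr))
    refine ((hp hb2).bdd_mul (continuous_gaussPoly (b / 2) (X i)).aestronglyMeasurable
      (Eventually.of_forall hbd)).congr (Eventually.of_forall fun x => ?_)
    simp only [gaussPoly_mul_gaussPoly, add_halves, mul_comm]

theorem memLp_gaussPoly {b : ℝ} (hb : 0 < b) (p : MvPolynomial (Fin N) ℝ) :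
    MemLp (gaussPoly b p) 2 volume := by
  rw [memLp_two_iff_integrable_sq (continuous_gaussPoly b p).aestronglyMeasurable]
  refine (integrable_gaussPoly (add_pos hb hb) (p * p)).congr (Eventually.of_forall fun x => ?_)
  simp only [← gaussPoly_mul_gaussPoly, sq]

theorem integral_gaussPoly_mul_pderiv {b : ℝ} (hb : 0 < b) (p q : MvPolynomial (Fin N) ℝ)
    (i : Fin N) :
    ∫ x, gaussPoly b (pderiv i p) x * gaussPoly b (pderiv i q) x
      = ∫ x, gaussPoly b p x
          * gaussPoly b ((4 * b) • (X i * pderiv i q) - pderiv i (pderiv i q)) x := by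
  have hint : ∀ r s : MvPolynomial (Fin N) ℝ,
      Integrable fun x => gaussPoly b r x * gaussPoly b s x :=
    fun r s => (memLp_gaussPoly hb r).integrable_mul (memLp_gaussPoly hb s)
  have hd : ∀ r : MvPolynomial (Fin N) ℝ, Differentiable ℝ (gaussPoly b r) :=
    fun r => (contDiff_gaussPoly b r).differentiable (by simp)
  have h := integral_mul_fderiv_eq_neg_fderiv_mul_of_integrable (μ := volume)
    (f := gaussPoly b p) (g := gaussPoly b (pderiv i q)) (v := EuclideanSpace.single i 1)
    (by simpa only [fderiv_gaussPoly] using hint _ _)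
    (by simpa only [fderiv_gaussPoly] using hint _ _) (hint _ _)
    (fun x _ => hd _ x) (fun x _ => hd _ x)
  simp only [fderiv_gaussPoly] at h
  rw [← sub_eq_zero, ← sub_eq_zero.2 h, ← integral_sub (hint _ _) (hint _ _), sub_neg_eq_add,
    ← integral_add (hint _ _) (hint _ _)]
  refine integral_congr_ae (Eventually.of_forall fun x => ?_)
  simp only [gaussPoly, map_sub, map_mul, smul_eval, eval_X]
  ring

theorem integral_mul_fderiv_of_hasCompactSupport {φ h : EuclideanSpace ℝ (Fin N) → ℝ}
    (hφ : IsTestFunction φ) (hh : ContDiff ℝ ∞ h) (v : EuclideanSpace ℝ (Fin N)) :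
    ∫ x, φ x * fderiv ℝ h x v = -∫ x, fderiv ℝ φ x v * h x := by
  have c1 : Continuous fun x => fderiv ℝ φ x v :=
    (hφ.1.continuous_fderiv (by simp)).clm_apply continuous_const
  have c2 : Continuous fun x => fderiv ℝ h x v :=
    (hh.continuous_fderiv (by simp)).clm_apply continuous_const
  refine integral_mul_fderiv_eq_neg_fderiv_mul_of_integrable ?_ ?_ ?_
    (fun x _ => hφ.1.differentiable (by simp) x) (fun x _ => hh.differentiable (by simp) x)
  · exact (c1.mul hh.continuous).integrable_of_hasCompactSupport
      ((hφ.2.fderiv_apply ℝ v).mul_right)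
  · exact (hφ.1.continuous.mul c2).integrable_of_hasCompactSupport hφ.2.mul_right
  · exact (hφ.1.continuous.mul hh.continuous).integrable_of_hasCompactSupport hφ.2.mul_right

/-! ### The energy inequality for test functions -/

theorem integrable_mul_of_memLp_two {α : Type*} [MeasurableSpace α] {μ : Measure α}
    {f g : α → ℝ} (hf : MemLp f 2 μ) (hg : MemLp g 2 μ) : Integrable (fun x => f x * g x) μ :=
  hf.integrable_mul hg

/-- The Dirichlet form of the number operator. -/
theorem integral_gaussPoly_mul_numberOp {t : ℝ} (ht : 0 < t) (p q : MvPolynomial (Fin N) ℝ) :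
    ∫ x, gaussPoly (1 / (2 * t)) p x * gaussPoly (1 / (2 * t)) (numberOp N t q) x
      = t / 2 * ∑ i, ∫ x, gaussPoly (1 / (2 * t)) (pderiv i p) x
          * gaussPoly (1 / (2 * t)) (pderiv i q) x := by
  have hb : 0 < 1 / (2 * t) := by positivity
  simp_rw [integral_gaussPoly_mul_pderiv hb]
  rw [← integral_finsetSum _ fun i _ =>
    integrable_mul_of_memLp_two (memLp_gaussPoly hb _) (memLp_gaussPoly hb _),
    ← integral_const_mul]
  refine integral_congr_ae (Eventually.of_forall fun x => ?_)
  simp only [numberOp_apply, gaussPoly, map_sum, map_sub, map_mul, smul_eval, eval_X]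
  simp only [Finset.sum_mul, Finset.mul_sum]
  refine Finset.sum_congr rfl fun i _ => ?_
  field_simp
  ring

theorem integral_numberOp_comm {t : ℝ} (ht : 0 < t) (p q : MvPolynomial (Fin N) ℝ) :
    ∫ x, gaussPoly (1 / (2 * t)) (numberOp N t p) x * gaussPoly (1 / (2 * t)) q x
      = ∫ x, gaussPoly (1 / (2 * t)) p x * gaussPoly (1 / (2 * t)) (numberOp N t q) x := by
  rw [integral_gaussPoly_mul_numberOp ht]
  simp_rw [mul_comm (gaussPoly _ (numberOp N t p) _)]
  rw [integral_gaussPoly_mul_numberOp ht]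
  simp_rw [mul_comm]

theorem integral_add_sub_sq_nonneg {α : Type*} [MeasurableSpace α] {μ : Measure α}
    {a b c : α → ℝ} (ha : MemLp a 2 μ) (hb : MemLp b 2 μ) (hc : MemLp c 2 μ) :
    0 ≤ (∫ x, a x * a x ∂μ) + (∫ x, b x * b x ∂μ) + (∫ x, c x * c x ∂μ)
      + 2 * (∫ x, a x * b x ∂μ) - 2 * ((∫ x, a x * c x ∂μ) + ∫ x, b x * c x ∂μ) := by
  have h : 0 ≤ ∫ x, (a x + b x - c x) ^ 2 ∂μ := integral_nonneg fun x => sq_nonneg _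
  have aa := ha.integrable_mul ha
  have bb := hb.integrable_mul hb
  have cc := hc.integrable_mul hc
  have ab := ha.integrable_mul hb
  have ac := ha.integrable_mul hc
  have bc := hb.integrable_mul hc
  have e : ∫ x, (a x + b x - c x) ^ 2 ∂μ
      = ∫ x, ((a * a + b * b + c * c + (2 : ℝ) • (a * b)) - (2 : ℝ) • (a * c + b * c)) x ∂μ := by
    refine integral_congr_ae (Eventually.of_forall fun x => ?_)
    simp only [Pi.sub_apply, Pi.add_apply, Pi.mul_apply, Pi.smul_apply, smul_eq_mul]
    ring
  rw [e, integral_sub' (((aa.add bb).add cc).add (ab.smul _)) ((ac.add bc).smul _),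
    integral_add' ((aa.add bb).add cc) (ab.smul _), integral_add' (aa.add bb) cc,
    integral_add' aa bb] at h
  simp only [Pi.smul_apply, integral_smul] at h
  rw [integral_add' ac bc] at h
  exact h

theorem norm_gradient_sq (φ : EuclideanSpace ℝ (Fin N) → ℝ) (x : EuclideanSpace ℝ (Fin N)) :
    ‖gradient φ x‖ ^ 2 = ∑ i, fderiv ℝ φ x (EuclideanSpace.single i 1) ^ 2 := by
  rw [EuclideanSpace.real_norm_sq_eq]
  refine Finset.sum_congr rfl fun i => ?_
  rw [← inner_gradient_left, EuclideanSpace.inner_single_right]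
  simp

theorem IsTestFunction.memLp_mul {φ h : EuclideanSpace ℝ (Fin N) → ℝ} (hφ : IsTestFunction φ)
    (hh : Continuous h) : MemLp (fun x => h x * φ x) 2 volume :=
  (hh.mul hφ.1.continuous).memLp_of_hasCompactSupport hφ.2.mul_left

theorem IsTestFunction.memLp {φ : EuclideanSpace ℝ (Fin N) → ℝ} (hφ : IsTestFunction φ) :
    MemLp φ 2 volume := by
  simpa using hφ.memLp_mul (h := fun _ => 1) continuous_const

theorem IsTestFunction.memLp_fderiv {φ : EuclideanSpace ℝ (Fin N) → ℝ} (hφ : IsTestFunction φ)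
    (v : EuclideanSpace ℝ (Fin N)) : MemLp (fun x => fderiv ℝ φ x v) 2 volume :=
  ((hφ.1.continuous_fderiv (by simp)).clm_apply continuous_const).memLp_of_hasCompactSupport
    (hφ.2.fderiv_apply ℝ v)

/-- The contribution of one coordinate to `IsTestFunction.energy_le`: the integral of
`(∂ᵢφ + xᵢφ/t - ∂ᵢp e^{-|x|²/(2t)})²` is nonnegative, and the mixed terms integrate by parts. -/
theorem IsTestFunction.coordinate_energy_le {t : ℝ} (ht : 0 < t)
    {φ : EuclideanSpace ℝ (Fin N) → ℝ} (hφ : IsTestFunction φ) (p : MvPolynomial (Fin N) ℝ)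
    (i : Fin N) :
    2 * (∫ x, φ x * gaussPoly (1 / (2 * t))
          (X i * pderiv i p - (t / 2) • pderiv i (pderiv i p)) x)
        - t / 2 * ∫ x, gaussPoly (1 / (2 * t)) (pderiv i p) x
          * gaussPoly (1 / (2 * t)) (pderiv i p) x
      ≤ (t * ∫ x, fderiv ℝ φ x (EuclideanSpace.single i 1) ^ 2) / 2
        + (∫ x, x i ^ 2 * φ x ^ 2) / t / 2 - 1 / 2 * ∫ x, φ x ^ 2 := by
  have hb : 0 < 1 / (2 * t) := by positivity
  set b := 1 / (2 * t) with hbt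
  set D : EuclideanSpace ℝ (Fin N) → ℝ := fun x => fderiv ℝ φ x (EuclideanSpace.single i 1)
    with hD
  have hDL : MemLp D 2 volume := hφ.memLp_fderiv _
  have hφL : MemLp φ 2 volume := hφ.memLp
  have hi : Continuous fun x : EuclideanSpace ℝ (Fin N) => x i := by fun_prop
  have hxL : MemLp (fun x => x i * φ x) 2 volume := hφ.memLp_mul hi
  have hG : ∀ q, MemLp (gaussPoly b q : EuclideanSpace ℝ (Fin N) → ℝ) 2 volume :=
    fun q => memLp_gaussPoly hb q
  have key := integral_add_sub_sq_nonneg hDL (hxL.const_mul (1 / t)) (hG (pderiv i p))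
  -- the mixed term `∫ x_i φ ∂_i φ` is `-1/2 ∫ φ²`
  have h1 : 2 * ∫ x, D x * (x i * φ x) = -∫ x, φ x ^ 2 := by
    have h := integral_mul_fderiv_of_hasCompactSupport hφ (h := fun x => x i * φ x)
      ((by fun_prop : ContDiff ℝ ∞ fun x : EuclideanSpace ℝ (Fin N) => x i).mul hφ.1)
      (EuclideanSpace.single i 1)
    have hd : ∀ x, fderiv ℝ (fun x : EuclideanSpace ℝ (Fin N) => x i * φ x) x
        (EuclideanSpace.single i 1) = x i * D x + φ x := by
      intro x
      have hX : fderiv ℝ (fun x : EuclideanSpace ℝ (Fin N) => x i) x = EuclideanSpace.proj i :=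
        (EuclideanSpace.proj i : EuclideanSpace ℝ (Fin N) →L[ℝ] ℝ).fderiv
      rw [fderiv_fun_mul (by fun_prop) (hφ.1.differentiable (by simp) x), hX]
      simp [hD]
    simp only [hd] at h
    have h2 : ∫ x, φ x * (x i * D x + φ x) = (∫ x, D x * (x i * φ x)) + ∫ x, φ x ^ 2 := by
      rw [← integral_add (integrable_mul_of_memLp_two hDL hxL) hφL.integrable_sq]
      refine integral_congr_ae (Eventually.of_forall fun x => ?_)
      ring
    rw [h2] at h
    linarith
  have h2 : (∫ x, D x * gaussPoly b (pderiv i p) x) + ∫ x, 1 / t * (x i * φ x)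
        * gaussPoly b (pderiv i p) x
      = 2 / t * ∫ x, φ x * gaussPoly b (X i * pderiv i p - (t / 2) • pderiv i (pderiv i p)) x := by
    have h := integral_mul_fderiv_of_hasCompactSupport hφ (contDiff_gaussPoly b (pderiv i p))
      (EuclideanSpace.single i 1)
    change _ = -∫ x, D x * _ at h
    simp only [fderiv_gaussPoly] at h
    rw [← neg_eq_iff_eq_neg.2 h, ← integral_const_mul, ← integral_neg,
      ← integral_add (integrable_mul_of_memLp_two hφL (hG _)).fun_neg
        (integrable_mul_of_memLp_two (hxL.const_mul (1 / t)) (hG _))]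
    refine integral_congr_ae (Eventually.of_forall fun x => ?_)
    simp only [gaussPoly, map_sub, map_mul, smul_eval, eval_X, hbt]
    field_simp
    ring
  have h3 : ∫ x, D x * (1 / t * (x i * φ x)) = 1 / t * ∫ x, D x * (x i * φ x) := by
    rw [← integral_const_mul]
    congr 1; ext x; ring
  have h4 : ∫ x, 1 / t * (x i * φ x) * (1 / t * (x i * φ x))
      = 1 / t ^ 2 * ∫ x, x i ^ 2 * φ x ^ 2 := by
    rw [← integral_const_mul]
    congr 1; ext x; ring
  have h5 : ∫ x, D x * D x = ∫ x, D x ^ 2 := by simp only [sq]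
  rw [h2, h3, h4, h5] at key
  have h6 := mul_le_mul_of_nonneg_left key (by positivity : 0 ≤ t / 2)
  have h7 : ∫ x, D x * (x i * φ x) = -(∫ x, φ x ^ 2) / 2 := by linarith
  rw [h7] at h6
  field_simp at h6 ⊢
  linarith

/-- The oscillator energy `Q` satisfies `Q(φ - w) ≥ 0` for `w = p e^{-|x|²/(2t)}`. As `w` is in the
domain of the oscillator, the mixed term is an `L²` pairing, without derivatives of `φ`. -/
theorem IsTestFunction.energy_le {t : ℝ} (ht : 0 < t) {φ : EuclideanSpace ℝ (Fin N) → ℝ}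
    (hφ : IsTestFunction φ) (p : MvPolynomial (Fin N) ℝ) :
    2 * (∫ x, φ x * gaussPoly (1 / (2 * t)) (numberOp N t p) x)
        - ∫ x, gaussPoly (1 / (2 * t)) p x * gaussPoly (1 / (2 * t)) (numberOp N t p) x
      ≤ (t * (∫ x, ‖gradient φ x‖ ^ 2) + (∫ x, (‖x‖ * φ x) ^ 2) / t) / 2
        - (N : ℝ) / 2 * ∫ x, φ x ^ 2 := by
  have hb : 0 < 1 / (2 * t) := by positivity
  have hφL : MemLp φ 2 volume := hφ.memLp
  have h := Finset.sum_le_sum fun i (_ : i ∈ Finset.univ) => hφ.coordinate_energy_le ht p i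
  simp only [Finset.sum_sub_distrib, Finset.sum_add_distrib, ← Finset.mul_sum,
    ← Finset.sum_div, Finset.sum_const, Finset.card_univ, Fintype.card_fin, nsmul_eq_mul] at h
  rw [integral_gaussPoly_mul_numberOp ht]
  have h1 : ∫ x, φ x * gaussPoly (1 / (2 * t)) (numberOp N t p) x
      = ∑ i, ∫ x, φ x * gaussPoly (1 / (2 * t))
          (X i * pderiv i p - (t / 2) • pderiv i (pderiv i p)) x := by
    rw [← integral_finsetSum _ fun i _ => integrable_mul_of_memLp_two hφL (memLp_gaussPoly hb _)]
    congr 1; ext x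
    simp only [numberOp_apply, gaussPoly, map_sum, Finset.sum_mul, Finset.mul_sum]
  have h2 : ∫ x, ‖gradient φ x‖ ^ 2
      = ∑ i, ∫ x, fderiv ℝ φ x (EuclideanSpace.single i 1) ^ 2 := by
    rw [← integral_finsetSum _ fun i _ => (hφ.memLp_fderiv _).integrable_sq]
    simp only [norm_gradient_sq]
  have h3 : ∫ x, (‖x‖ * φ x) ^ 2 = ∑ i, ∫ x, x i ^ 2 * φ x ^ 2 := by
    rw [← integral_finsetSum]
    · congr 1; ext x
      rw [mul_pow, EuclideanSpace.real_norm_sq_eq, Finset.sum_mul]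
    · intro i _
      have := (hφ.memLp_mul (by fun_prop : Continuous fun x : EuclideanSpace ℝ (Fin N) => x i))
      simpa only [mul_pow] using this.integrable_sq
  rw [h1, h2, h3]
  linarith

/-! ### Completeness of the Hermite functions -/

/-- Completeness of the Hermite functions: polynomials times a Gaussian are total in `L²`. If `f` is
orthogonal to all of them, expanding the exponential shows that `f e^{-b|x|²}` has vanishing Fourier
transform. -/
theorem ae_eq_zero_of_forall_integral_mul_gaussPoly {b : ℝ} (hb : 0 < b)
    {f : EuclideanSpace ℝ (Fin N) → ℝ} (hf : MemLp f 2 volume)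
    (h : ∀ p, ∫ x, f x * gaussPoly b p x = 0) : f =ᵐ[volume] 0 := by
  have hgp : ∀ x, Real.exp (-b * ‖x‖ ^ 2) = gaussPoly (N := N) b 1 x := by simp [gaussPoly]
  set k : EuclideanSpace ℝ (Fin N) → ℝ := fun x => f x * Real.exp (-b * ‖x‖ ^ 2) with hk
  have hkint : Integrable k := by
    simp only [hk, hgp]
    exact hf.integrable_mul (memLp_gaussPoly hb 1)
  -- the Fourier transform of `k` vanishes
  have hF : ∀ ξ : EuclideanSpace ℝ (Fin N),
      ∫ x, (k x : ℂ) * Complex.exp ((inner ℝ x ξ : ℝ) * Complex.I) = 0 := by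
    intro ξ
    have hsum := hasSum_integral_of_dominated_convergence (μ := volume)
      (F := fun (n : ℕ) x => (k x : ℂ) * (((inner ℝ x ξ : ℝ) * Complex.I) ^ n / n.factorial))
      (f := fun x => (k x : ℂ) * Complex.exp ((inner ℝ x ξ : ℝ) * Complex.I))
      (fun (n : ℕ) x => |k x| * ((‖x‖ * ‖ξ‖) ^ n / n.factorial)) ?_ ?_ ?_ ?_ ?_
    · refine hsum.unique ?_
      convert hasSum_zero with n
      have hp : ∀ x : EuclideanSpace ℝ (Fin N), (k x : ℂ) *
          (((inner ℝ x ξ : ℝ) * Complex.I) ^ n / n.factorial)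
          = (Complex.I ^ n / n.factorial) *
            ((f x * gaussPoly b ((∑ i, C (ξ i) * X i) ^ n) x : ℝ) : ℂ) := by
        intro x
        have : (inner ℝ x ξ : ℝ) = ∑ i, ξ i * x i := by
          rw [PiLp.inner_apply]
          simp
        simp only [hk, gaussPoly, map_pow, map_sum, map_mul, eval_C, eval_X, this]
        push_cast
        ring
      simp only [hp]
      rw [integral_const_mul, integral_complex_ofReal, h]
      simp
    · intro n
      refine (Complex.continuous_ofReal.comp_aestronglyMeasurable hkint.1).mul ?_
      exact Continuous.aestronglyMeasurable (by fun_prop)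
    · intro n
      refine Eventually.of_forall fun x => ?_
      simp only [norm_mul, norm_div, norm_pow, Complex.norm_real, Complex.norm_I, mul_one,
        Complex.norm_natCast, Real.norm_eq_abs]
      gcongr
      exact abs_real_inner_le_norm x ξ
    · exact Eventually.of_forall fun x =>
        (Real.summable_pow_div_factorial (‖x‖ * ‖ξ‖)).mul_left _
    · have he : ∀ x : EuclideanSpace ℝ (Fin N),
          ∑' n : ℕ, |k x| * ((‖x‖ * ‖ξ‖) ^ n / n.factorial) = |k x| * Real.exp (‖x‖ * ‖ξ‖) := by
        intro x
        rw [tsum_mul_left, Real.exp_eq_exp_ℝ, NormedSpace.exp_eq_tsum_div]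
      simp only [he]
      have hdom := (hf.norm.integrable_mul (memLp_gaussPoly (half_pos hb) 1)).const_mul
        (Real.exp (‖ξ‖ ^ 2 / (2 * b)))
      refine hdom.mono' ?_ (Eventually.of_forall fun x => ?_)
      · exact hkint.1.norm.mul (Continuous.aestronglyMeasurable (by fun_prop))
      · simp only [hk, gaussPoly, map_one, one_mul, abs_mul, Real.abs_exp, Real.norm_eq_abs,
          abs_abs, Pi.mul_apply]
        rw [mul_assoc, mul_left_comm (Real.exp (‖ξ‖ ^ 2 / (2 * b))), ← Real.exp_add,
          ← Real.exp_add]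
        refine mul_le_mul_of_nonneg_left (Real.exp_le_exp.2 ?_) (abs_nonneg _)
        -- complete the square
        have : ‖ξ‖ ^ 2 / (2 * b) + -(b / 2) * ‖x‖ ^ 2 - (-b * ‖x‖ ^ 2 + ‖x‖ * ‖ξ‖)
            = (b * ‖x‖ - ‖ξ‖) ^ 2 / (2 * b) := by
          field_simp
          ring
        have h0 : 0 ≤ (b * ‖x‖ - ‖ξ‖) ^ 2 / (2 * b) := by positivity
        linarith
    · refine Eventually.of_forall fun x => HasSum.mul_left _ ?_
      rw [Complex.exp_eq_exp_ℂ]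
      exact NormedSpace.expSeries_div_hasSum_exp _
  -- hence the measures with densities `k⁺` and `k⁻` have the same characteristic function
  have hm : AEMeasurable k := hkint.1.aemeasurable
  have hm' : AEMeasurable (fun x => -k x) volume := hm.neg
  have fin1 : IsFiniteMeasure (volume.withDensity fun x => ENNReal.ofReal (k x)) :=
    isFiniteMeasure_withDensity_ofReal hkint.2
  have fin2 : IsFiniteMeasure (volume.withDensity fun x => ENNReal.ofReal (-k x)) :=
    isFiniteMeasure_withDensity_ofReal hkint.neg.2
  have hcf : (volume.withDensity fun x => ENNReal.ofReal (k x))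
      = volume.withDensity fun x => ENNReal.ofReal (-k x) := by
    refine Measure.ext_of_charFun (funext fun ξ => ?_)
    have hexp : AEStronglyMeasurable (fun x : EuclideanSpace ℝ (Fin N) =>
        Complex.exp ((inner ℝ x ξ : ℝ) * Complex.I)) volume :=
      Continuous.aestronglyMeasurable (by fun_prop)
    have hbd : ∀ᵐ x : EuclideanSpace ℝ (Fin N),
        ‖Complex.exp ((inner ℝ x ξ : ℝ) * Complex.I)‖ ≤ 1 :=
      Eventually.of_forall fun x => (Complex.norm_exp_ofReal_mul_I _).le
    have hi : ∀ s : EuclideanSpace ℝ (Fin N) → ℝ, Integrable s → Integrable fun x =>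
        s x • Complex.exp ((inner ℝ x ξ : ℝ) * Complex.I) := by
      intro s hs
      refine (hs.ofReal.bdd_mul (𝕜 := ℂ) hexp hbd).congr (Eventually.of_forall fun x => ?_)
      simp [mul_comm]
    rw [charFun_apply, charFun_apply,
      integral_withDensity_eq_integral_toReal_smul₀ hm.ennreal_ofReal
        (Eventually.of_forall fun _ => ENNReal.ofReal_lt_top),
      integral_withDensity_eq_integral_toReal_smul₀ hm'.ennreal_ofReal
        (Eventually.of_forall fun _ => ENNReal.ofReal_lt_top), ← sub_eq_zero]
    simp only [ENNReal.toReal_ofReal']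
    rw [← integral_sub (hi _ hkint.pos_part) (hi _ hkint.neg_part), ← hF ξ]
    refine integral_congr_ae (Eventually.of_forall fun x => ?_)
    beta_reduce
    rw [← sub_smul, max_zero_sub_max_neg_zero_eq_self]
    simp
  rw [withDensity_eq_iff hm.ennreal_ofReal hm'.ennreal_ofReal
    hkint.lintegral_lt_top.ne] at hcf
  filter_upwards [hcf] with x hx
  have hk0 : k x = 0 := by
    have h1 := congrArg ENNReal.toReal hx
    simp only [ENNReal.toReal_ofReal'] at h1
    have h2 := max_zero_sub_max_neg_zero_eq_self (k x)
    linarith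
  simpa [hk, (Real.exp_pos _).ne'] using hk0

/-! ### Passage to `L²` -/

theorem inner_toLp_toLp {α : Type*} [MeasurableSpace α] {μ : Measure α} {f g : α → ℝ}
    (hf : MemLp f 2 μ) (hg : MemLp g 2 μ) :
    inner ℝ (hf.toLp f) (hg.toLp g) = ∫ x, f x * g x ∂μ := by
  rw [L2.inner_def]
  refine integral_congr_ae ?_
  filter_upwards [hf.coeFn_toLp, hg.coeFn_toLp] with x h1 h2
  rw [h1, h2, real_inner_eq_re_inner]
  simp [mul_comm]

theorem norm_toLp_sq {α F : Type*} [MeasurableSpace α] {μ : Measure α} [NormedAddCommGroup F]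
    [InnerProductSpace ℝ F] {f : α → F} (hf : MemLp f 2 μ) :
    ‖hf.toLp f‖ ^ 2 = ∫ x, ‖f x‖ ^ 2 ∂μ := by
  rw [← real_inner_self_eq_norm_sq, L2.inner_def]
  refine integral_congr_ae ?_
  filter_upwards [hf.coeFn_toLp] with x h1
  rw [h1, real_inner_self_eq_norm_sq]

/-- Multiplication by a Gaussian, from polynomials to `L²`. -/
noncomputable def gaussPolyLp {b : ℝ} (hb : 0 < b) :
    MvPolynomial (Fin N) ℝ →ₗ[ℝ] Lp ℝ 2 (volume : Measure (EuclideanSpace ℝ (Fin N))) where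
  toFun p := (memLp_gaussPoly hb p).toLp _
  map_add' p q := by
    rw [← MemLp.toLp_add]
    congr 1; ext x
    exact gaussPoly_add b p q x
  map_smul' c p := by
    rw [RingHom.id_apply, ← MemLp.toLp_const_smul]
    congr 1; ext x
    exact gaussPoly_smul b c p x

theorem gaussPolyLp_apply {b : ℝ} (hb : 0 < b) (p : MvPolynomial (Fin N) ℝ) :
    gaussPolyLp hb p = (memLp_gaussPoly hb p).toLp _ := rfl

theorem topologicalClosure_iSup_map_gaussPolyLp {b : ℝ} (hb : 0 < b) :
    (⨆ n, (degreeLT N n).map (gaussPolyLp hb)).topologicalClosure = ⊤ := by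
  rw [← Submodule.map_iSup, iSup_degreeLT, Submodule.topologicalClosure_eq_top_iff, eq_bot_iff]
  intro f hf
  rw [Submodule.mem_orthogonal] at hf
  rw [Submodule.mem_bot, Lp.eq_zero_iff_ae_eq_zero]
  refine ae_eq_zero_of_forall_integral_mul_gaussPoly hb (Lp.memLp f) fun p => ?_
  have h := hf _ (Submodule.mem_map_of_mem (f := gaussPolyLp hb) (Submodule.mem_top (x := p)))
  rw [← inner_toLp_toLp (Lp.memLp f) (memLp_gaussPoly hb p), Lp.toLp_coeFn, real_inner_comm]
  exact h

/-- Any upper bound `E` for the oscillator energy of `u`, in the sense that `u` satisfies the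
inequality of `IsTestFunction.energy_le`, bounds the distance to a Gaussian plus the distance to an
affine function times that Gaussian. -/
theorem exists_integral_sq_add_le {t : ℝ} (ht : 0 < t) {u : EuclideanSpace ℝ (Fin N) → ℝ}
    (hu : MemLp u 2 volume) {E : ℝ}
    (hE : ∀ p, 2 * (∫ x, u x * gaussPoly (1 / (2 * t)) (numberOp N t p) x)
      - ∫ x, gaussPoly (1 / (2 * t)) p x * gaussPoly (1 / (2 * t)) (numberOp N t p) x ≤ E) :
    ∃ (c : ℝ) (d : EuclideanSpace ℝ (Fin N)),
      ∫ x, (|u x - c * Real.exp (-(1 / (2 * t)) * ‖x‖ ^ 2)| ^ 2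
        + |u x - (c + inner ℝ d x) * Real.exp (-(1 / (2 * t)) * ‖x‖ ^ 2)| ^ 2) ≤ E := by
  have hb : 0 < 1 / (2 * t) := by positivity
  obtain ⟨p₀, hp₀, p₁, hp₁, h⟩ := exists_norm_sub_sq_add_le_of_graded
    (gaussPolyLp (N := N) hb) (numberOp N t) (degreeLT N) degreeLT_zero degreeLT_mono
    (fun n => inferInstance) (topologicalClosure_iSup_map_gaussPolyLp hb).ge
    (fun p q => by
      simp only [gaussPolyLp_apply, inner_toLp_toLp]
      exact integral_numberOp_comm ht p q)
    (fun k p hp => numberOp_sub_smul_mem t k hp) (hu.toLp u) E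
    (fun p => by
      simp only [gaussPolyLp_apply, inner_toLp_toLp]
      exact hE p)
  obtain ⟨d, hd⟩ := numberOp_eq_of_mem_degreeLT_two t hp₁
  rw [← map_add, gaussPolyLp_apply, gaussPolyLp_apply, ← MemLp.toLp_sub, ← MemLp.toLp_sub,
    norm_toLp_sq, norm_toLp_sq, ← integral_add (hu.sub (memLp_gaussPoly hb _)).norm.integrable_sq
      (hu.sub (memLp_gaussPoly hb _)).norm.integrable_sq] at h
  refine ⟨coeff 0 p₀, WithLp.toLp 2 d, le_of_eq_of_le (integral_congr_ae ?_) h⟩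
  refine Eventually.of_forall fun x => ?_
  rw [hd, eq_C_of_mem_degreeLT_one hp₀]
  simp only [gaussPoly, Pi.sub_apply, Real.norm_eq_abs, map_add, map_sum, map_mul, eval_C, eval_X,
    coeff_C, if_true, PiLp.inner_apply]
  simp

/-! ### Test functions and the space `S₀` -/

theorem IsTestFunction.sub {φ ψ : EuclideanSpace ℝ (Fin N) → ℝ} (hφ : IsTestFunction φ)
    (hψ : IsTestFunction ψ) : IsTestFunction fun x => φ x - ψ x :=
  ⟨hφ.1.sub hψ.1, hφ.2.sub hψ.2⟩

theorem IsTestFunction.gradient_sub {φ ψ : EuclideanSpace ℝ (Fin N) → ℝ} (hφ : IsTestFunction φ)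
    (hψ : IsTestFunction ψ) (x : EuclideanSpace ℝ (Fin N)) :
    gradient (fun x => φ x - ψ x) x = gradient φ x - gradient ψ x := by
  rw [gradient, fderiv_fun_sub (hφ.1.differentiable (by simp) x)
    (hψ.1.differentiable (by simp) x), map_sub]
  rfl

theorem IsTestFunction.memLp_norm_mul {φ : EuclideanSpace ℝ (Fin N) → ℝ}
    (hφ : IsTestFunction φ) : MemLp (fun x => ‖x‖ * φ x) 2 volume :=
  hφ.memLp_mul continuous_norm

theorem IsTestFunction.memLp_gradient {φ : EuclideanSpace ℝ (Fin N) → ℝ}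
    (hφ : IsTestFunction φ) : MemLp (gradient φ) 2 volume := by
  have hc : Continuous (gradient φ) := (InnerProductSpace.toDual ℝ
    (EuclideanSpace ℝ (Fin N))).symm.continuous.comp (hφ.1.continuous_fderiv (by simp))
  refine hc.memLp_of_hasCompactSupport ?_
  exact (hφ.2.fderiv ℝ).comp_left (map_zero _)

/-- The additive Heisenberg inequality, with `1 ≤ N` absorbing the dimensional constant. It makes the
norm of `S₀` control the `L²` norm. -/
theorem IsTestFunction.eLpNorm_le (hN : 1 ≤ N) {φ : EuclideanSpace ℝ (Fin N) → ℝ}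
    (hφ : IsTestFunction φ) :
    eLpNorm φ 2 volume ≤ eLpNorm (gradient φ) 2 volume
      + eLpNorm (fun x => ‖x‖ * φ x) 2 volume := by
  have h := hφ.energy_le one_pos 0
  have hsq : ∫ x, φ x ^ 2 = ‖hφ.memLp.toLp φ‖ ^ 2 := by
    simp only [norm_toLp_sq, Real.norm_eq_abs, sq_abs]
  have hxsq : ∫ x, (‖x‖ * φ x) ^ 2 = ‖hφ.memLp_norm_mul.toLp _‖ ^ 2 := by
    simp only [norm_toLp_sq, Real.norm_eq_abs, sq_abs]
  have hgp : gaussPoly (1 / (2 * 1)) (0 : MvPolynomial (Fin N) ℝ) = 0 := by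
    ext x; simp [gaussPoly]
  rw [hsq, hxsq, ← norm_toLp_sq hφ.memLp_gradient, map_zero, hgp] at h
  simp only [Pi.zero_apply, mul_zero, integral_zero, sub_zero, one_mul, div_one] at h
  have hN' : (1 : ℝ) ≤ N := by exact_mod_cast hN
  have hle : ‖hφ.memLp.toLp φ‖
      ≤ ‖hφ.memLp_gradient.toLp _‖ + ‖hφ.memLp_norm_mul.toLp _‖ := by
    refine abs_le_of_sq_le_sq' ?_ (by positivity) |>.2
    have h1 := mul_le_mul_of_nonneg_right hN' (sq_nonneg ‖hφ.memLp.toLp φ‖)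
    have h2 : 0 ≤ ‖hφ.memLp_gradient.toLp _‖ * ‖hφ.memLp_norm_mul.toLp _‖ := by positivity
    nlinarith
  rw [← Lp.enorm_toLp hφ.memLp, ← Lp.enorm_toLp hφ.memLp_gradient,
    ← Lp.enorm_toLp hφ.memLp_norm_mul, ← ofReal_norm, ← ofReal_norm, ← ofReal_norm,
    ← ENNReal.ofReal_add (norm_nonneg _) (norm_nonneg _)]
  exact ENNReal.ofReal_le_ofReal hle

theorem memLp_of_tendsto_eLpNorm {α F : Type*} [MeasurableSpace α] {μ : Measure α}
    [NormedAddCommGroup F] {f : α → F} {g : ℕ → α → F} (hf : AEStronglyMeasurable f μ)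
    (hg : ∀ n, MemLp (g n) 2 μ)
    (h : Tendsto (fun n => eLpNorm (g n - f) 2 μ) atTop (𝓝 0)) : MemLp f 2 μ := by
  obtain ⟨n, hn⟩ := (h.eventually_lt_const ENNReal.zero_lt_top).exists
  have h1 : MemLp (g n - f) 2 μ := ⟨(hg n).1.sub hf, hn⟩
  simpa using (hg n).sub h1

/-- Convergence of test functions in the norm of `S₀` implies `L²` convergence to the same limit. The
sequence is `L²`-Cauchy by `IsTestFunction.eLpNorm_le`; a subsequence converges almost everywhere
away from the origin, and Fatou's lemma identifies the limit. -/
theorem tendsto_eLpNorm_sub_of_tendsto_gradient (hN : 1 ≤ N) {u : EuclideanSpace ℝ (Fin N) → ℝ}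
    {G : EuclideanSpace ℝ (Fin N) → EuclideanSpace ℝ (Fin N)}
    {φ : ℕ → EuclideanSpace ℝ (Fin N) → ℝ} (hφ : ∀ n, IsTestFunction (φ n))
    (hum : AEStronglyMeasurable u volume) (hGm : AEStronglyMeasurable G volume)
    (h1 : Tendsto (fun n => eLpNorm (gradient (φ n) - G) 2 volume) atTop (𝓝 0))
    (h2 : Tendsto (fun n => eLpNorm ((fun x => ‖x‖ * φ n x) - fun x => ‖x‖ * u x) 2 volume)
      atTop (𝓝 0)) :
    Tendsto (fun n => eLpNorm (φ n - u) 2 volume) atTop (𝓝 0) := by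
  have hxm : AEStronglyMeasurable (fun x => ‖x‖ * u x) volume :=
    continuous_norm.aestronglyMeasurable.mul hum
  set ε : ℕ → ENNReal := fun n => eLpNorm (gradient (φ n) - G) 2 volume
    + eLpNorm ((fun x => ‖x‖ * φ n x) - fun x => ‖x‖ * u x) 2 volume with hε
  have hε0 : Tendsto ε atTop (𝓝 0) := by simpa using h1.add h2
  have hcauchy : ∀ m n, eLpNorm (φ m - φ n) 2 volume ≤ ε m + ε n := by
    intro m n
    refine (((hφ m).sub (hφ n)).eLpNorm_le hN).trans ?_
    have e1 : gradient (fun x => φ m x - φ n x)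
        = (gradient (φ m) - G) - (gradient (φ n) - G) := by
      ext1 x
      simp [(hφ m).gradient_sub (hφ n)]
    have e2 : (fun x => ‖x‖ * (φ m x - φ n x))
        = ((fun x => ‖x‖ * φ m x) - fun x => ‖x‖ * u x)
          - ((fun x => ‖x‖ * φ n x) - fun x => ‖x‖ * u x) := by
      ext1 x
      simp only [Pi.sub_apply]
      ring
    rw [e1, e2]
    refine (add_le_add
      (eLpNorm_sub_le ((hφ m).memLp_gradient.1.sub hGm) ((hφ n).memLp_gradient.1.sub hGm)
        one_le_two)
      (eLpNorm_sub_le ((hφ m).memLp_norm_mul.1.sub hxm) ((hφ n).memLp_norm_mul.1.sub hxm)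
        one_le_two)).trans (le_of_eq ?_)
    simp only [hε]
    ring
  obtain ⟨ns, hns, hae⟩ := (tendstoInMeasure_of_tendsto_eLpNorm two_ne_zero
    (fun n => (hφ n).memLp_norm_mul.1) hxm h2).exists_seq_tendsto_ae
  have : Nonempty (Fin N) := ⟨⟨0, hN⟩⟩
  have hne : ∀ᵐ x : EuclideanSpace ℝ (Fin N), x ≠ 0 := Measure.ae_ne volume 0
  refine tendsto_of_tendsto_of_tendsto_of_le_of_le tendsto_const_nhds hε0
    (fun _ => zero_le) fun n => ?_
  have hlim : ∀ᵐ x, Tendsto (fun j => (φ (ns j) - φ n) x) atTop (𝓝 ((u - φ n) x)) := by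
    filter_upwards [hae, hne] with x hx hx0
    have hx1 := (hx.const_mul ‖x‖⁻¹).sub_const (φ n x)
    simpa [inv_mul_cancel_left₀ (norm_ne_zero_iff.2 hx0)] using hx1
  have hfatou := Lp.eLpNorm_lim_le_liminf_eLpNorm (p := 2)
    (fun j => (hφ (ns j)).memLp.1.sub (hφ n).memLp.1) (u - φ n) hlim
  have hlim2 : Tendsto (fun j => ε (ns j) + ε n) atTop (𝓝 (ε n)) := by
    simpa using (hε0.comp hns.tendsto_atTop).add_const (ε n)
  show eLpNorm (φ n - u) 2 volume ≤ ε n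
  rw [eLpNorm_sub_comm, ← hlim2.liminf_eq]
  exact hfatou.trans (liminf_le_liminf (Eventually.of_forall fun j => hcauchy _ _))

/-- `IsTestFunction.energy_le` passes to limits in `S₀`. -/
theorem MemS0.energy_le (hN : 1 ≤ N) {u : EuclideanSpace ℝ (Fin N) → ℝ} (hu : MemS0 u) :
    MemLp u 2 volume ∧ ∀ t : ℝ, 0 < t → ∀ p : MvPolynomial (Fin N) ℝ,
      2 * (∫ x, u x * gaussPoly (1 / (2 * t)) (numberOp N t p) x)
        - ∫ x, gaussPoly (1 / (2 * t)) p x * gaussPoly (1 / (2 * t)) (numberOp N t p) x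
      ≤ (t * (∫ x, ‖weakGradient u x‖ ^ 2) + (∫ x, |u x| ^ 2 * ‖x‖ ^ 2) / t) / 2
        - (N : ℝ) / 2 * ∫ x, |u x| ^ 2 := by
  obtain ⟨hG, φ, hφ, hlim⟩ := hu
  obtain ⟨hul, hGl, -⟩ := IsWeakGradient.weakGradient hG
  set G := weakGradient u
  have hum := hul.aestronglyMeasurable
  have hGm := hGl.aestronglyMeasurable
  have hxm : AEStronglyMeasurable (fun x => ‖x‖ * u x) volume :=
    continuous_norm.aestronglyMeasurable.mul hum
  have h1 : Tendsto (fun n => eLpNorm (gradient (φ n) - G) 2 volume) atTop (𝓝 0) := by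
    refine tendsto_of_tendsto_of_tendsto_of_le_of_le tendsto_const_nhds hlim
      (fun _ => zero_le) fun n => ?_
    rw [eLpNorm_sub_comm]
    exact le_self_add
  have h2 : Tendsto (fun n => eLpNorm ((fun x => ‖x‖ * φ n x) - fun x => ‖x‖ * u x) 2 volume)
      atTop (𝓝 0) := by
    refine tendsto_of_tendsto_of_tendsto_of_le_of_le tendsto_const_nhds hlim
      (fun _ => zero_le) fun n => ?_
    rw [eLpNorm_sub_comm]
    have : ((fun x => ‖x‖ * u x) - fun x => ‖x‖ * φ n x) = fun x => ‖x‖ * (u x - φ n x) := by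
      ext1 x
      simp only [Pi.sub_apply]
      ring
    rw [this]
    exact le_add_self
  have h0 := tendsto_eLpNorm_sub_of_tendsto_gradient hN hφ hum hGm h1 h2
  have huL := memLp_of_tendsto_eLpNorm hum (fun n => (hφ n).memLp) h0
  have hGL := memLp_of_tendsto_eLpNorm hGm (fun n => (hφ n).memLp_gradient) h1
  have hxL := memLp_of_tendsto_eLpNorm hxm (fun n => (hφ n).memLp_norm_mul) h2
  refine ⟨huL, fun t ht p => ?_⟩
  have l0 := (Lp.tendsto_Lp_iff_tendsto_eLpNorm'' _ (fun n => (hφ n).memLp) _ huL).2 h0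
  have l1 := (Lp.tendsto_Lp_iff_tendsto_eLpNorm'' _ (fun n => (hφ n).memLp_gradient) _ hGL).2 h1
  have l2 := (Lp.tendsto_Lp_iff_tendsto_eLpNorm'' _ (fun n => (hφ n).memLp_norm_mul) _ hxL).2 h2
  have hb : 0 < 1 / (2 * t) := by positivity
  have hw := memLp_gaussPoly hb (numberOp N t p)
  have hL := ((l0.inner (tendsto_const_nhds (x := hw.toLp _))).const_mul 2).sub_const
    (∫ x, gaussPoly (1 / (2 * t)) p x * gaussPoly (1 / (2 * t)) (numberOp N t p) x)
  have hR := (((l1.norm.pow 2).const_mul t).add ((l2.norm.pow 2).div_const t)).div_const 2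
    |>.sub ((l0.norm.pow 2).const_mul ((N : ℝ) / 2))
  simp only [inner_toLp_toLp, norm_toLp_sq] at hL hR
  have hle := le_of_tendsto_of_tendsto' hL hR fun n => by
    simpa only [Real.norm_eq_abs, sq_abs] using (hφ n).energy_le ht p
  simpa only [Real.norm_eq_abs, sq_abs, mul_pow, mul_comm (‖_‖ ^ 2) (u _ ^ 2)] using hle

/-! ### The deficit and the distances -/

/-- Optimization over the dilation parameter. The minimizer `t = √B / √A` does not exist when `A` or
`B` vanishes, so both square roots are shifted by `ε`. -/
theorem le_sqrt_mul_sqrt_of_forall {K A B : ℝ} (hA : 0 ≤ A) (hB : 0 ≤ B)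
    (h : ∀ t, 0 < t → K ≤ (t * A + B / t) / 2) : K ≤ √A * √B := by
  have hlim : Tendsto (fun ε : ℝ => √A * √B + ε * (√A + √B) / 2) (𝓝[>] 0)
      (𝓝 (√A * √B + 0 * (√A + √B) / 2)) :=
    ((Continuous.tendsto (by fun_prop) 0)).mono_left nhdsWithin_le_nhds
  rw [zero_mul, zero_div, add_zero] at hlim
  refine ge_of_tendsto hlim ?_
  filter_upwards [self_mem_nhdsWithin] with ε hε
  have hε : 0 < ε := hε
  have hM := Real.sqrt_nonneg A
  have hX := Real.sqrt_nonneg B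
  refine (h ((√B + ε) / (√A + ε)) (by positivity)).trans ?_
  have e1 : (√B + ε) / (√A + ε) * A ≤ (√B + ε) * √A := by
    rw [div_mul_eq_mul_div, div_le_iff₀ (by positivity)]
    nlinarith [Real.sq_sqrt hA, mul_nonneg (mul_nonneg hX hM) hε.le, mul_nonneg hM hε.le,
      mul_nonneg (mul_nonneg hM hε.le) hε.le]
  have e2 : B / ((√B + ε) / (√A + ε)) ≤ (√A + ε) * √B := by
    rw [div_div_eq_mul_div, div_le_iff₀ (by positivity)]
    nlinarith [Real.sq_sqrt hB, mul_nonneg (mul_nonneg hX hM) hε.le, mul_nonneg hX hε.le,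
      mul_nonneg (mul_nonneg hX hε.le) hε.le]
  linarith

theorem dist2_nonneg (u : EuclideanSpace ℝ (Fin N) → ℝ) : 0 ≤ dist2 u :=
  Real.iInf_nonneg fun _ => Real.sqrt_nonneg _

theorem distL2_nonneg (u : EuclideanSpace ℝ (Fin N) → ℝ)
    (A : Set (EuclideanSpace ℝ (Fin N) → ℝ)) : 0 ≤ distL2 u A :=
  Real.iInf_nonneg fun _ => Real.sqrt_nonneg _

theorem distL2_sq_le {u v : EuclideanSpace ℝ (Fin N) → ℝ}
    {A : Set (EuclideanSpace ℝ (Fin N) → ℝ)} (hv : v ∈ A) :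
    distL2 u A ^ 2 ≤ ∫ x, |u x - v x| ^ 2 := by
  have hbdd : BddBelow (Set.range fun v : A => √(∫ x, |u x - v.1 x| ^ 2)) :=
    ⟨0, by rintro _ ⟨v, rfl⟩; exact Real.sqrt_nonneg _⟩
  have h : distL2 u A ≤ √(∫ x, |u x - v x| ^ 2) := ciInf_le hbdd ⟨v, hv⟩
  exact (Real.le_sqrt (distL2_nonneg u A) (integral_nonneg fun x => by positivity)).1 h

theorem dist2_sq_le (u : EuclideanSpace ℝ (Fin N) → ℝ) (c : ℝ) (d : EuclideanSpace ℝ (Fin N))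
    {lam : ℝ} (hlam : lam ≠ 0) :
    dist2 u ^ 2 ≤ ∫ x, (|u x - c * Real.exp (-(1 / (2 * lam ^ 2)) * ‖x‖ ^ 2)| ^ 2
      + |u x - (c + inner ℝ d x) * Real.exp (-(1 / (2 * lam ^ 2)) * ‖x‖ ^ 2)| ^ 2) := by
  refine (Real.le_sqrt (dist2_nonneg u) (integral_nonneg fun x => by positivity)).1 ?_
  exact ciInf_le (f := fun p : ℝ × EuclideanSpace ℝ (Fin N) × {lam : ℝ // lam ≠ 0} =>
    √(∫ x, (|u x - p.1 * Real.exp (-(1 / (2 * p.2.2.1 ^ 2)) * ‖x‖ ^ 2)| ^ 2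
      + |u x - (p.1 + inner ℝ p.2.1 x) * Real.exp (-(1 / (2 * p.2.2.1 ^ 2)) * ‖x‖ ^ 2)| ^ 2)))
    ⟨0, by rintro _ ⟨v, rfl⟩; exact Real.sqrt_nonneg _⟩ (c, d, ⟨lam, hlam⟩)

theorem dist2_sq_le_deficit (hN : 1 ≤ N) {u : EuclideanSpace ℝ (Fin N) → ℝ} (hu : MemS0 u) :
    dist2 u ^ 2 ≤ deficit u := by
  obtain ⟨huL, hE⟩ := MemS0.energy_le hN hu
  have key : dist2 u ^ 2 + (N : ℝ) / 2 * ∫ x, |u x| ^ 2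
      ≤ √(∫ x, ‖weakGradient u x‖ ^ 2) * √(∫ x, |u x| ^ 2 * ‖x‖ ^ 2) := by
    refine le_sqrt_mul_sqrt_of_forall (integral_nonneg fun x => by positivity)
      (integral_nonneg fun x => by positivity) fun t ht => ?_
    obtain ⟨c, d, h⟩ := exists_integral_sq_add_le ht huL (hE t ht)
    have hd := dist2_sq_le u c d (Real.sqrt_pos.2 ht).ne'
    rw [Real.sq_sqrt ht.le] at hd
    linarith
  rw [deficit]
  linarith

theorem memLp_affine_mul_exp {b : ℝ} (hb : 0 < b) (c : ℝ) (d : EuclideanSpace ℝ (Fin N)) :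
    MemLp (fun x => (c + inner ℝ d x) * Real.exp (-b * ‖x‖ ^ 2)) 2 volume := by
  convert memLp_gaussPoly hb (C c + ∑ i, X i * C (d i)) using 2 with x
  simp [gaussPoly, PiLp.inner_apply]

theorem distL2_sq_add_le_dist2_sq {u : EuclideanSpace ℝ (Fin N) → ℝ} (hu : MemLp u 2 volume) :
    distL2 u (gaussians N) ^ 2 + distL2 u (affineGaussians N) ^ 2 ≤ dist2 u ^ 2 := by
  have h : √(distL2 u (gaussians N) ^ 2 + distL2 u (affineGaussians N) ^ 2) ≤ dist2 u := by
    have : Nonempty {lam : ℝ // lam ≠ 0} := ⟨⟨1, one_ne_zero⟩⟩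
    refine le_ciInf fun ⟨c, d, lam, hlam⟩ => Real.sqrt_le_sqrt ?_
    have hb : 0 < 1 / (2 * lam ^ 2) := by positivity
    have m1 : MemLp (fun x : EuclideanSpace ℝ (Fin N) =>
        c * Real.exp (-(1 / (2 * lam ^ 2)) * ‖x‖ ^ 2)) 2 volume := by
      simpa using memLp_affine_mul_exp (N := N) hb c 0
    have g1 : _ ∈ gaussians N := ⟨c, _, hb, rfl⟩
    have g2 : _ ∈ affineGaussians N := ⟨c, d, _, hb, rfl⟩
    exact (add_le_add (distL2_sq_le g1) (distL2_sq_le g2)).trans_eq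
      (integral_add (hu.sub m1).norm.integrable_sq
        (hu.sub (memLp_affine_mul_exp hb c d)).norm.integrable_sq).symm
  rwa [Real.sqrt_le_left (dist2_nonneg u)] at h

end HUP

theorem theorem1p9 (N : ℕ) (hN : 1 ≤ N) (u : EuclideanSpace ℝ (Fin N) → ℝ) (hu : HUP.MemS0 u) :
    MemLp u 2 volume ∧
    HUP.deficit u ≥ HUP.dist2 u ^ 2 ∧
    HUP.deficit u - HUP.distL2 u (HUP.gaussians N) ^ 2
      ≥ HUP.distL2 u (HUP.affineGaussians N) ^ 2 := by
  have huL := (HUP.MemS0.energy_le hN hu).1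
  have h1 := HUP.dist2_sq_le_deficit hN hu
  have h2 := HUP.distL2_sq_add_le_dist2_sq huL
  exact ⟨huL, h1, by linarith⟩
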